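/- Let $n \ge 0$ and let $\mathrm{Invol}(S_n)=\{\sigma\in S_n : \sigma^2=1\}$ (the identity included). For $\pi,\sigma\in S_n$ write $\pi\le\sigma$ (Bruhat order) if $\pi$ is the product of a (not necessarily contiguous) subword of a reduced word of $\sigma$ in the Coxeter generators $s_i=(i,i+1)$, $1\le i\le n-1$. For $\sigma\in \mathrm{Invol}(S_n)$ let $r_{ij}$ be the rank of the upper-left $i\times j$ submatrix of the permutation matrix of $\sigma$ (with $r_{0j}=0$ for all $j \ge 0$), and put $$\mathfrak D(\sigma)=\#\{(i,j) : 1\le i\le j\le n,\ r_{ij}=r_{i-1,j-1}\}.$$ Let $\mathrm{exc}(\sigma)=\#\{i : \sigma(i)>i\}$ and $\mathrm{inv}(\sigma)=\#\{(i,j) : i<j,\ \sigma(i)>\sigma(j)\}$. Then $(\mathrm{Invol}(S_n),\le)$ is a partially ordered set, and it is graded: for all $x,y\in\mathrm{Invol}(S_n)$, any two maximal chains from $x$ to $y$ have the same length. Its rank function is $\mathfrak D$, that is, $\mathfrak D$ vanishes on minimal elements and $\mathfrak D(y)=\mathfrak D(x)+1$ whenever $y$ covers $x$ in $\mathrm{Invol}(S_n)$;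 and for every $\sigma\in \mathrm{Invol}(S_n)$ $$\mathfrak D(\sigma)=\frac{\mathrm{exc}(\sigma)+\mathrm{inv}(\sigma)}{2}.$$ -/

import Mathlib

namespace BruhatInvol

/-! ### Chains, gradedness and rank functions for an order relation `r` -/

section Order

variable {α : Type*}

/-- `C` is a maximal chain from `x` to `y`: a chain of elements of the interval `[x, y]` that
contains both `x` and `y`, and that is maximal (for inclusion) among such chains. -/
def IsMaximalChainFromTo (r : α → α → Prop) (x y : α) (C : Set α) : Prop :=
  Maximal (fun D : Set α => IsChain r D ∧ x ∈ D ∧ y ∈ D ∧ ∀ z ∈ D, r x z ∧ r z y) C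

/-- The length of a (nonempty) chain: its number of elements minus one. -/
noncomputable def chainLength (C : Set α) : ℕ∞ := C.encard - 1

/-- `r` is graded: any two maximal chains from `x` to `y` have the same length. -/
def IsGraded (r : α → α → Prop) : Prop :=
  ∀ x y : α, ∀ C C' : Set α, IsMaximalChainFromTo r x y C → IsMaximalChainFromTo r x y C' →
    chainLength C = chainLength C'

/-- `y` covers `x`: `x < y` and there is nothing strictly between. -/
def Covers (r : α → α → Prop) (x y : α) : Prop :=
  r x y ∧ x ≠ y ∧ ∀ z, r x z → r z y → z = x ∨ z = y

/-- `ρ` is a rank function: it vanishes on minimal elements and increases by one along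
every covering relation. -/
def IsRankFunction (r : α → α → Prop) (ρ : α → ℕ) : Prop :=
  (∀ x, (∀ z, r z x → z = x) → ρ x = 0) ∧ ∀ x y, Covers r x y → ρ y = ρ x + 1

end Order

/-! ### The Bruhat order on `S_n`, realised as `Equiv.Perm (Fin n)` -/

/-- The Coxeter generator `s_{i+1} = (i+1, i+2)` of `S_n` (here `Fin n` is numbered from `0`). -/
def adjSwap (n : ℕ) (i : Fin (n - 1)) : Equiv.Perm (Fin n) :=
  Equiv.swap ⟨i, by omega⟩ ⟨i + 1, by omega⟩

/-- The product in `S_n` of a word in the Coxeter generators. -/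
def wordProd (n : ℕ) (w : List (Fin (n - 1))) : Equiv.Perm (Fin n) :=
  (w.map (adjSwap n)).prod

/-- `w` is a reduced word of `σ`: a word of minimal length with product `σ`. -/
def IsReducedWord {n : ℕ} (w : List (Fin (n - 1))) (σ : Equiv.Perm (Fin n)) : Prop :=
  wordProd n w = σ ∧ ∀ w' : List (Fin (n - 1)), wordProd n w' = σ → w.length ≤ w'.length

/-- The Bruhat order: `π ≤ σ` if `π` is the product of a (not necessarily contiguous) subword
of a reduced word of `σ`. -/
def BruhatLE {n : ℕ} (π σ : Equiv.Perm (Fin n)) : Prop :=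
  ∃ w : List (Fin (n - 1)), IsReducedWord w σ ∧
    ∃ u : List (Fin (n - 1)), u.Sublist w ∧ wordProd n u = π

/-- The involutions of `S_n` (the identity included). -/
abbrev Invol (n : ℕ) : Type := {σ : Equiv.Perm (Fin n) // σ * σ = 1}

/-- The Bruhat order restricted to the involutions. -/
def involLE (n : ℕ) (π σ : Invol n) : Prop := BruhatLE π.1 σ.1

/-! ### Permutation statistics -/

/-- The number of excedances of `σ`. -/
def exc {n : ℕ} (σ : Equiv.Perm (Fin n)) : ℕ :=
  (Finset.univ.filter fun i : Fin n => i < σ i).card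

/-- The number of inversions of `σ`. -/
def invCount {n : ℕ} (σ : Equiv.Perm (Fin n)) : ℕ :=
  (Finset.univ.filter fun p : Fin n × Fin n => p.1 < p.2 ∧ σ p.2 < σ p.1).card

/-- The entry `r_{kl}` of the rank-control matrix of `X`: the rank of the upper-left `k × l`
submatrix of `X`. It is `0` if `k = 0` or `l = 0`. -/
noncomputable def rankControl {n : ℕ} (X : Matrix (Fin n) (Fin n) ℂ) (k l : ℕ) : ℕ :=
  (X.submatrix (fun i : {i : Fin n // (i : ℕ) < k} => i.1)
    (fun j : {j : Fin n // (j : ℕ) < l} => j.1)).rank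

/-- The parameter `𝔇`: the number of `(i, j)` with `1 ≤ i ≤ j ≤ n` and `r_{ij} = r_{i-1,j-1}`
in the rank-control matrix, extended by `r_{0k} = 0`. (The pair `p` of elements of `Fin n`
stands for `(i, j) = (p.1 + 1, p.2 + 1)`.) -/
noncomputable def diagEq {n : ℕ} (X : Matrix (Fin n) (Fin n) ℂ) : ℕ :=
  (Finset.univ.filter fun p : Fin n × Fin n =>
    p.1 ≤ p.2 ∧ rankControl X (p.1 + 1) (p.2 + 1) = rankControl X p.1 p.2).card

/-- The parameter `𝔇(σ)` of an involution, computed from its permutation matrix. -/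
noncomputable def rankParam {n : ℕ} (σ : Invol n) : ℕ := diagEq (σ.1.permMatrix ℂ)

end BruhatInvol

/-! Bruhat order is the reversed pointwise order of the rank matrices `rk` (`bruhatLE_iff_rankLE`).
In these terms an ascent or descent of `σ` at `k` says that row `k + 1` is the mean of rows `k` and
`k + 2`, rounded up or down. Forcing a descent (`upR`) or an ascent (`downR`) rewrites that single
row by a monotone formula, so both maps preserve the order. Applied on the right and then on the
left, they give order-preserving maps `up` and `down` on involutions.

For an involution with an ascent at `k`, `up` multiplies by `s` if `σ` fixes both points that `s`
moves, and conjugates by `s` otherwise. The pair (exc, inv) grows by (1, 1) or (0, 2), so its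
half-sum grows by one. That half-sum is `rankParam`, by counting the cells `(i, j)` with `j < σ i`
and `i < σ j` (`two_mul_rankParam`).

Gradedness then reduces to one property, `HasCoatoms`: if `x < y`, some `z` in `[x, y]` has rank one
less than `y`. It is proved by induction on the rank of `y`, pushing `x` and `y` down at a descent
of `y` and lifting the interpolating element back (`hasCoatoms_invol`). -/

namespace BruhatInvol

/-! ### Gradedness from interpolation by elements of corank one. -/

section Order

variable {α : Type*} {r : α → α → Prop} {ρ : α → ℕ}

/-- A rank-like function for which every strict relation `x < y` can be interpolated by some
`z` of rank one less than `y`. -/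
def HasCoatoms (r : α → α → Prop) (ρ : α → ℕ) : Prop :=
  ∀ x y, r x y → x ≠ y → ∃ z, r x z ∧ r z y ∧ ρ y = ρ z + 1

theorem HasCoatoms.rank_lt (h : HasCoatoms r ρ) {x y : α} (hxy : r x y) (hne : x ≠ y) :
    ρ x < ρ y := by
  induction hm : ρ y using Nat.strong_induction_on generalizing y with
  | _ m ih =>
    obtain ⟨z, hxz, -, hz⟩ := h x y hxy hne
    by_cases hx : x = z
    · subst hx; omega
    · have := ih (ρ z) (by omega) hxz hx rfl
      omega

theorem HasCoatoms.covers (h : HasCoatoms r ρ) {x y : α} (hc : Covers r x y) :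
    ρ y = ρ x + 1 := by
  obtain ⟨z, hxz, hzy, hz⟩ := h x y hc.1 hc.2.1
  rcases hc.2.2 z hxz hzy with rfl | rfl
  · exact hz
  · omega

/-- Ranks are injective on a chain, and on a maximal chain they fill the whole interval: across a
gap one could insert another element. -/
theorem HasCoatoms.encard_maximalChain (hrefl : ∀ x, r x x) (htrans : ∀ x y z, r x y → r y z → r x z)
    (h : HasCoatoms r ρ) {x y : α} {C : Set α} (hC : IsMaximalChainFromTo r x y C) :
    C.encard = (Set.Icc (ρ x) (ρ y)).encard := by
  obtain ⟨⟨hch, hx, hy, hb⟩, hmax⟩ := hC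
  have hmono : ∀ a b, r a b → ρ a ≤ ρ b := fun a b hab => by
    by_cases e : a = b
    · rw [e]
    · exact (h.rank_lt hab e).le
  have hinj : Set.InjOn ρ C := by
    intro a ha b hb' hab
    by_contra hne
    rcases hch ha hb' hne with h1 | h1
    · exact absurd (h.rank_lt h1 hne) (by omega)
    · exact absurd (h.rank_lt h1 (Ne.symm hne)) (by omega)
  have hle : ∀ a ∈ C, ∀ b ∈ C, ρ a ≤ ρ b → r a b := by
    intro a ha b hb' hab
    by_cases e : a = b
    · rw [e]; exact hrefl b
    · rcases hch ha hb' e with h1 | h1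
      · exact h1
      · exact absurd (h.rank_lt h1 (Ne.symm e)) (by omega)
  rw [← hinj.encard_image]
  congr 1
  ext m
  constructor
  · rintro ⟨c, hc, rfl⟩
    exact ⟨hmono _ _ (hb c hc).1, hmono _ _ (hb c hc).2⟩
  · rintro ⟨hm1, hm2⟩
    by_contra hm
    -- the least rank of `C` above `m`, and its element `d`
    have hex : ∃ k, m ≤ k ∧ k ∈ ρ '' C := ⟨ρ y, hm2, y, hy, rfl⟩
    classical
    obtain ⟨hk, d, hd, hdk⟩ := Nat.find_spec hex
    have hmin := fun k => Nat.find_min (H := hex) (m := k)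
    rw [← hdk] at hk hmin
    have hne : ρ d ≠ m := fun e => hm ⟨d, hd, e⟩
    have hxd : x ≠ d := by rintro rfl; omega
    -- elements of `C` below `d`: take the one of largest rank
    have hfin : (ρ '' C ∩ Set.Iio m).Finite := (Set.finite_Iio m).subset Set.inter_subset_right
    have hxm : ρ x ≠ m := fun e => hm ⟨x, hx, e⟩
    obtain ⟨k, ⟨⟨c, hc, rfl⟩, hcm⟩, hcmax⟩ :=
      Set.exists_max_image _ id hfin ⟨ρ x, ⟨x, hx, rfl⟩, show ρ x < m by omega⟩
    simp only [Set.mem_Iio, id] at hcm hcmax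
    have hcd : c ≠ d := by rintro rfl; omega
    -- `z` has rank `ρ d - 1`, which is at least `m`. Once `z` is known to lie in `C`, this
    -- contradicts either the gap at `m` or the choice of `d`.
    obtain ⟨z, hcz, hzd, hz⟩ := h c d (hle c hc d hd (by omega)) hcd
    have hsplit : ∀ a ∈ C, r a c ∨ r d a := by
      intro a ha
      rcases lt_or_ge (ρ a) m with h1 | h1
      · exact Or.inl (hle _ ha _ hc (hcmax _ ⟨⟨a, ha, rfl⟩, h1⟩))
      · refine Or.inr (hle _ hd _ ha ?_)
        by_contra h2
        exact hmin (ρ a) (by omega) ⟨h1, a, ha, rfl⟩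
    have hzC : z ∈ C := by
      have := hmax (y := insert z C) ⟨?_, Set.mem_insert_of_mem _ hx, Set.mem_insert_of_mem _ hy, ?_⟩
        (Set.subset_insert z C)
      · exact this (Set.mem_insert z C)
      · refine hch.insert fun a ha _ => ?_
        rcases hsplit a ha with h1 | h1
        · exact Or.inr (htrans _ _ _ h1 hcz)
        · exact Or.inl (htrans _ _ _ hzd h1)
      · rintro w (rfl | hw)
        · exact ⟨htrans _ _ _ (hb c hc).1 hcz, htrans _ _ _ hzd (hb d hd).2⟩
        · exact hb w hw
    have hzm : ρ z ≠ m := fun e => hm ⟨z, hzC, e⟩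
    exact hmin (ρ z) (by omega) ⟨by omega, z, hzC, rfl⟩

theorem HasCoatoms.isGraded (hrefl : ∀ x, r x x) (htrans : ∀ x y z, r x y → r y z → r x z)
    (h : HasCoatoms r ρ) : IsGraded r := by
  intro x y C C' hC hC'
  rw [chainLength, chainLength, h.encard_maximalChain hrefl htrans hC,
    h.encard_maximalChain hrefl htrans hC']

end Order

/-! ### Adjacent transpositions. -/

section Permutations

open Equiv

variable {n : ℕ}

theorem adjSwap_val (k : Fin (n - 1)) (p : Fin n) :
    ((adjSwap n k p : Fin n) : ℕ) =
      if (p : ℕ) = k then (k : ℕ) + 1 else if (p : ℕ) = k + 1 then (k : ℕ) else p := by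
  rw [adjSwap, swap_apply_def]
  simp only [Fin.ext_iff]
  split_ifs <;> rfl

@[simp] theorem adjSwap_mul_self (k : Fin (n - 1)) : adjSwap n k * adjSwap n k = 1 :=
  swap_mul_self _ _

@[simp] theorem adjSwap_apply_self (k : Fin (n - 1)) (p : Fin n) :
    adjSwap n k (adjSwap n k p) = p :=
  swap_apply_self _ _ _

@[simp] theorem adjSwap_inv (k : Fin (n - 1)) : (adjSwap n k)⁻¹ = adjSwap n k :=
  swap_inv _ _

@[simp] theorem mul_adjSwap_mul_self (σ : Perm (Fin n)) (k : Fin (n - 1)) :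
    σ * adjSwap n k * adjSwap n k = σ := by
  rw [mul_assoc, adjSwap_mul_self, mul_one]

/-- The left one of the two points moved by `adjSwap n k`. -/
def lo (k : Fin (n - 1)) : Fin n := ⟨k, by omega⟩

/-- The right one of the two points moved by `adjSwap n k`. -/
def hi (k : Fin (n - 1)) : Fin n := ⟨k + 1, by omega⟩

@[simp] theorem lo_val (k : Fin (n - 1)) : ((lo k : Fin n) : ℕ) = k := rfl

@[simp] theorem hi_val (k : Fin (n - 1)) : ((hi k : Fin n) : ℕ) = k + 1 := rfl

@[simp] theorem adjSwap_lo (k : Fin (n - 1)) : adjSwap n k (lo k) = hi k := swap_apply_left _ _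

@[simp] theorem adjSwap_hi (k : Fin (n - 1)) : adjSwap n k (hi k) = lo k := swap_apply_right _ _

theorem lo_lt_hi (k : Fin (n - 1)) : (lo k : Fin n) < hi k := by simp [Fin.lt_def]

theorem adjSwap_lt_iff (k : Fin (n - 1)) {p q : Fin n} (h1 : ¬(p = lo k ∧ q = hi k))
    (h2 : ¬(p = hi k ∧ q = lo k)) : adjSwap n k p < adjSwap n k q ↔ p < q := by
  simp only [Fin.ext_iff, lo_val, hi_val] at h1 h2
  rw [Fin.lt_def, Fin.lt_def, adjSwap_val, adjSwap_val]
  split_ifs <;> omega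

/-! ### Ascents and lengths -/

/-- `σ` has an ascent at `k`. -/
def IsAsc (σ : Perm (Fin n)) (k : Fin (n - 1)) : Prop := σ (lo k) < σ (hi k)

theorem isAsc_mul_adjSwap_iff (σ : Perm (Fin n)) (k : Fin (n - 1)) :
    IsAsc (σ * adjSwap n k) k ↔ ¬ IsAsc σ k := by
  have : σ (lo k) ≠ σ (hi k) := fun h => (lo_lt_hi k).ne (σ.injective h)
  simp only [IsAsc, Perm.mul_apply, adjSwap_lo, adjSwap_hi, not_lt]
  exact ⟨le_of_lt, fun h => lt_of_le_of_ne h this.symm⟩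

theorem eq_one_of_forall_isAsc (σ : Perm (Fin n)) (h : ∀ k, IsAsc σ k) : σ = 1 := by
  cases n with
  | zero => exact Subsingleton.elim _ _
  | succ m =>
    have hm : StrictMono σ := Fin.strictMono_iff_lt_succ.2 fun i => h i
    have := Subsingleton.elim (hm.orderIsoOfSurjective σ σ.surjective) (OrderIso.refl _)
    ext i
    exact congrArg Fin.val (DFunLike.congr_fun this i)

/-- The transposition reverses the order of no pair but its own two points, so it carries the old
inversions to new ones, and `(lo k, hi k)` is the only addition. -/
theorem invCount_mul_adjSwap {σ : Perm (Fin n)} {k : Fin (n - 1)} (h : IsAsc σ k) :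
    invCount (σ * adjSwap n k) = invCount σ + 1 := by
  have hs : (adjSwap n k).symm = adjSwap n k := adjSwap_inv k
  have hmem : (lo k, hi k) ∉ (Finset.univ.filter fun p : Fin n × Fin n =>
      p.1 < p.2 ∧ σ p.2 < σ p.1).map ((adjSwap n k).prodCongr (adjSwap n k)).toEmbedding := by
    simp [hs, (lo_lt_hi k).le]
  rw [invCount, invCount, ← Finset.card_map (s := Finset.univ.filter fun p : Fin n × Fin n =>
      p.1 < p.2 ∧ σ p.2 < σ p.1) ((adjSwap n k).prodCongr (adjSwap n k)).toEmbedding,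
    ← Finset.card_cons hmem]
  congr 1
  ext ⟨p, q⟩
  rw [Finset.mem_cons, Finset.mem_map_equiv, Finset.mem_filter, Finset.mem_filter]
  simp only [Finset.mem_univ, true_and, Prod.mk.injEq, Perm.mul_apply,
    prodCongr_symm, prodCongr_apply, Prod.map, hs]
  by_cases h1 : p = lo k ∧ q = hi k
  · obtain ⟨rfl, rfl⟩ := h1
    simpa [lo_lt_hi] using (show σ (lo k) < σ (hi k) from h)
  by_cases h2 : p = hi k ∧ q = lo k
  · obtain ⟨rfl, rfl⟩ := h2
    simp only [IsAsc] at h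
    simp [(lo_lt_hi k).not_gt, lo_lt_hi, (lo_lt_hi k).ne', h.not_gt]
  rw [adjSwap_lt_iff k h1 h2]
  tauto

theorem invCount_of_not_isAsc {σ : Perm (Fin n)} {k : Fin (n - 1)} (h : ¬ IsAsc σ k) :
    invCount σ = invCount (σ * adjSwap n k) + 1 := by
  have := invCount_mul_adjSwap ((isAsc_mul_adjSwap_iff σ k).2 h)
  rwa [mul_adjSwap_mul_self] at this

@[simp] theorem invCount_one : invCount (1 : Perm (Fin n)) = 0 := by
  simp only [invCount, Finset.card_eq_zero, Finset.filter_eq_empty_iff]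
  rintro p - ⟨h1, h2⟩
  exact lt_asymm h1 h2

@[simp] theorem wordProd_nil : wordProd n [] = 1 := rfl

theorem wordProd_concat (w : List (Fin (n - 1))) (k : Fin (n - 1)) :
    wordProd n (w ++ [k]) = wordProd n w * adjSwap n k := by
  simp [wordProd]

theorem invCount_mul_adjSwap_le (σ : Perm (Fin n)) (k : Fin (n - 1)) :
    invCount (σ * adjSwap n k) ≤ invCount σ + 1 := by
  by_cases h : IsAsc σ k
  · exact (invCount_mul_adjSwap h).le
  · have := invCount_of_not_isAsc h
    omega

theorem invCount_wordProd_le (w : List (Fin (n - 1))) : invCount (wordProd n w) ≤ w.length := by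
  induction w using List.reverseRecOn with
  | nil => simp
  | append_singleton w k ih =>
    rw [wordProd_concat, List.length_append]
    exact (invCount_mul_adjSwap_le _ k).trans (Nat.add_le_add_right ih 1)

theorem exists_wordProd_eq (σ : Perm (Fin n)) :
    ∃ w, wordProd n w = σ ∧ w.length = invCount σ := by
  induction hm : invCount σ using Nat.strong_induction_on generalizing σ with
  | _ m ih =>
    by_cases h : ∀ k, IsAsc σ k
    · have := eq_one_of_forall_isAsc σ h
      subst this
      exact ⟨[], rfl, by rw [← hm, invCount_one]; rfl⟩
    · push Not at h
      obtain ⟨k, hk⟩ := h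
      have hi := invCount_of_not_isAsc hk
      obtain ⟨w, hw, hl⟩ := ih _ (by omega) (σ * adjSwap n k) rfl
      exact ⟨w ++ [k], by rw [wordProd_concat, hw, mul_adjSwap_mul_self],
        by rw [List.length_append, List.length_singleton]; omega⟩

theorem isReducedWord_iff {w : List (Fin (n - 1))} {σ : Perm (Fin n)} :
    IsReducedWord w σ ↔ wordProd n w = σ ∧ w.length = invCount σ := by
  constructor
  · rintro ⟨rfl, h⟩
    obtain ⟨w', hw', hl⟩ := exists_wordProd_eq (wordProd n w)
    exact ⟨rfl, le_antisymm (hl ▸ h w' hw') (invCount_wordProd_le w)⟩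
  · rintro ⟨rfl, h⟩
    exact ⟨rfl, fun w' hw' => h ▸ hw' ▸ invCount_wordProd_le w'⟩

/-! ### The rank order -/

/-- The number of ones in the upper-left `i × j` submatrix of the permutation matrix. -/
def rk (σ : Perm (Fin n)) (i j : ℕ) : ℕ :=
  (Finset.univ.filter fun k : Fin n => (k : ℕ) < i ∧ (σ k : ℕ) < j).card

theorem rk_succ (σ : Perm (Fin n)) (k : Fin n) (j : ℕ) :
    rk σ (k + 1) j = rk σ k j + if (σ k : ℕ) < j then 1 else 0 := by
  rw [rk, rk]
  have hk : k ∉ Finset.univ.filter fun a : Fin n => (a : ℕ) < k ∧ (σ a : ℕ) < j := by simp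
  split_ifs with h
  · rw [← Finset.card_cons hk]
    congr 1
    ext a
    simp only [Finset.mem_filter, Finset.mem_univ, true_and, Finset.mem_cons]
    constructor
    · rintro ⟨h1, h2⟩
      by_cases e : a = k
      · exact Or.inl e
      · exact Or.inr ⟨by have := Fin.val_ne_of_ne e; omega, h2⟩
    · rintro (rfl | h1)
      · exact ⟨by omega, h⟩
      · exact ⟨by omega, h1.2⟩
  · rw [add_zero]
    congr 1
    ext a
    simp only [Finset.mem_filter, Finset.mem_univ, true_and]
    constructor
    · rintro ⟨h1, h2⟩
      have e : a ≠ k := by rintro rfl; exact h h2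
      exact ⟨by have := Fin.val_ne_of_ne e; omega, h2⟩
    · rintro h1
      exact ⟨by omega, h1.2⟩

theorem rk_inv (σ : Perm (Fin n)) (i j : ℕ) : rk σ⁻¹ i j = rk σ j i := by
  rw [rk, rk]
  refine Finset.card_equiv σ⁻¹ fun a => ?_
  simp [and_comm]

theorem rk_mul_adjSwap_of_ne (σ : Perm (Fin n)) (k : Fin (n - 1)) {i : ℕ} (hi : i ≠ k + 1)
    (j : ℕ) : rk (σ * adjSwap n k) i j = rk σ i j := by
  rw [rk, rk]
  refine Finset.card_equiv (adjSwap n k) fun a => ?_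
  rw [Finset.mem_filter, Finset.mem_filter, Perm.mul_apply, adjSwap_val]
  simp only [Finset.mem_univ, true_and]
  refine and_congr_left fun _ => ?_
  split_ifs <;> omega

/-- The pointwise order on rank matrices, reversed. -/
def RankLE (π σ : Perm (Fin n)) : Prop := ∀ i j, rk σ i j ≤ rk π i j

theorem RankLE.refl (σ : Perm (Fin n)) : RankLE σ σ := fun _ _ => le_rfl

theorem RankLE.trans {π σ τ : Perm (Fin n)} (h : RankLE π σ) (h' : RankLE σ τ) : RankLE π τ :=
  fun i j => (h' i j).trans (h i j)

/-- Differences of consecutive rows of the rank matrix recover the permutation. -/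
theorem RankLE.antisymm {π σ : Perm (Fin n)} (h : RankLE π σ) (h' : RankLE σ π) : π = σ := by
  have e : ∀ i j, rk π i j = rk σ i j := fun i j => le_antisymm (h' i j) (h i j)
  ext k
  have key : ∀ j, (π k : ℕ) < j ↔ (σ k : ℕ) < j := fun j => by
    have h1 := rk_succ π k j
    rw [e, e, rk_succ σ k j] at h1
    split_ifs at h1 <;> omega
  have h1 := key (π k + 1)
  have h2 := key (σ k + 1)
  omega

theorem RankLE.inv {π σ : Perm (Fin n)} (h : RankLE π σ) : RankLE π⁻¹ σ⁻¹ := fun i j => by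
  rw [rk_inv, rk_inv]
  exact h j i

/-! ### Sorting two adjacent positions is monotone. -/

open Classical in
/-- The larger one of `σ` and `σ * adjSwap n k`. -/
noncomputable def upR (k : Fin (n - 1)) (σ : Perm (Fin n)) : Perm (Fin n) :=
  if IsAsc σ k then σ * adjSwap n k else σ

open Classical in
/-- The smaller one of `σ` and `σ * adjSwap n k`. -/
noncomputable def downR (k : Fin (n - 1)) (σ : Perm (Fin n)) : Perm (Fin n) :=
  if IsAsc σ k then σ else σ * adjSwap n k

/-- The two steps from row `k` to row `k + 2` are 0 or 1, and at an ascent the first is at least the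
second; hence the mean rounded up. At a descent it is rounded down. -/
theorem rk_of_isAsc {σ : Perm (Fin n)} {k : Fin (n - 1)} (h : IsAsc σ k) (j : ℕ) :
    rk σ (k + 1) j = (rk σ k j + rk σ (k + 2) j + 1) / 2 := by
  have h1 := rk_succ σ (lo k) j
  have h2 := rk_succ σ (hi k) j
  rw [IsAsc, Fin.lt_def] at h
  simp only [lo_val, hi_val] at h1 h2
  rw [show (k : ℕ) + 2 = k + 1 + 1 by omega]
  split_ifs at h1 h2 <;> omega

theorem rk_of_not_isAsc {σ : Perm (Fin n)} {k : Fin (n - 1)} (h : ¬ IsAsc σ k) (j : ℕ) :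
    rk σ (k + 1) j = (rk σ k j + rk σ (k + 2) j) / 2 := by
  have h1 := rk_succ σ (lo k) j
  have h2 := rk_succ σ (hi k) j
  rw [IsAsc, Fin.lt_def] at h
  simp only [lo_val, hi_val] at h1 h2
  rw [show (k : ℕ) + 2 = k + 1 + 1 by omega]
  split_ifs at h1 h2 <;> omega

theorem not_isAsc_upR (k : Fin (n - 1)) (σ : Perm (Fin n)) : ¬ IsAsc (upR k σ) k := by
  rw [upR]
  split_ifs with h
  · rw [isAsc_mul_adjSwap_iff]; exact not_not.2 h
  · exact h

theorem isAsc_downR (k : Fin (n - 1)) (σ : Perm (Fin n)) : IsAsc (downR k σ) k := by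
  rw [downR]
  split_ifs with h
  · exact h
  · rwa [isAsc_mul_adjSwap_iff]

theorem rk_upR_of_ne (k : Fin (n - 1)) (σ : Perm (Fin n)) {i : ℕ} (hi : i ≠ k + 1) (j : ℕ) :
    rk (upR k σ) i j = rk σ i j := by
  rw [upR]
  split_ifs
  · exact rk_mul_adjSwap_of_ne σ k hi j
  · rfl

theorem rk_downR_of_ne (k : Fin (n - 1)) (σ : Perm (Fin n)) {i : ℕ} (hi : i ≠ k + 1) (j : ℕ) :
    rk (downR k σ) i j = rk σ i j := by
  rw [downR]
  split_ifs
  · rfl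
  · exact rk_mul_adjSwap_of_ne σ k hi j

theorem RankLE.upR {π σ : Perm (Fin n)} (h : RankLE π σ) (k : Fin (n - 1)) :
    RankLE (upR k π) (upR k σ) := fun i j => by
  by_cases hi : i = k + 1
  · subst hi
    rw [rk_of_not_isAsc (not_isAsc_upR k π), rk_of_not_isAsc (not_isAsc_upR k σ)]
    have h1 := h k j
    have h2 := h (k + 2) j
    repeat rw [rk_upR_of_ne k _ (by omega)]
    omega
  · rw [rk_upR_of_ne k _ hi, rk_upR_of_ne k _ hi]
    exact h i j

theorem RankLE.downR {π σ : Perm (Fin n)} (h : RankLE π σ) (k : Fin (n - 1)) :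
    RankLE (downR k π) (downR k σ) := fun i j => by
  by_cases hi : i = k + 1
  · subst hi
    rw [rk_of_isAsc (isAsc_downR k π), rk_of_isAsc (isAsc_downR k σ)]
    have h1 := h k j
    have h2 := h (k + 2) j
    repeat rw [rk_downR_of_ne k _ (by omega)]
    omega
  · rw [rk_downR_of_ne k _ hi, rk_downR_of_ne k _ hi]
    exact h i j

theorem rankLE_upR (k : Fin (n - 1)) (σ : Perm (Fin n)) : RankLE σ (upR k σ) := fun i j => by
  by_cases hi : i = k + 1
  · subst hi
    rw [rk_of_not_isAsc (not_isAsc_upR k σ), rk_upR_of_ne k _ (by omega),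
      rk_upR_of_ne k _ (by omega)]
    by_cases h : IsAsc σ k
    · rw [rk_of_isAsc h]; omega
    · rw [rk_of_not_isAsc h]
  · rw [rk_upR_of_ne k _ hi]

theorem downR_upR_of_isAsc {k : Fin (n - 1)} {σ : Perm (Fin n)} (h : IsAsc σ k) :
    downR k (upR k σ) = σ := by
  rw [downR, if_neg (not_isAsc_upR k σ), upR, if_pos h, mul_adjSwap_mul_self]

theorem upR_downR_of_not_isAsc {k : Fin (n - 1)} {σ : Perm (Fin n)} (h : ¬ IsAsc σ k) :
    upR k (downR k σ) = σ := by
  rw [upR, if_pos (isAsc_downR k σ), downR, if_neg h, mul_adjSwap_mul_self]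

theorem rankLE_downR (k : Fin (n - 1)) (σ : Perm (Fin n)) : RankLE (downR k σ) σ := by
  by_cases h : IsAsc σ k
  · rw [downR, if_pos h]; exact RankLE.refl σ
  · have := rankLE_upR k (downR k σ)
    rwa [upR_downR_of_not_isAsc h] at this

theorem one_rankLE (σ : Perm (Fin n)) : RankLE 1 σ := by
  induction hm : invCount σ using Nat.strong_induction_on generalizing σ with
  | _ m ih =>
    by_cases h : ∀ k, IsAsc σ k
    · rw [eq_one_of_forall_isAsc σ h]; exact RankLE.refl 1
    · push Not at h
      obtain ⟨k, hk⟩ := h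
      have hi := invCount_of_not_isAsc hk
      refine (ih (invCount (downR k σ)) ?_ _ rfl).trans (rankLE_downR k σ)
      rw [downR, if_neg hk]; omega

/-! ### The subword order equals the rank order. -/

theorem RankLE.of_sublist_reducedWord {w u : List (Fin (n - 1))} (hu : u.Sublist w)
    (hw : w.length = invCount (wordProd n w)) : RankLE (wordProd n u) (wordProd n w) := by
  induction w using List.reverseRecOn generalizing u with
  | nil => rw [List.sublist_nil.1 hu]; exact RankLE.refl _
  | append_singleton w k ih =>
    have h1 := invCount_wordProd_le w
    rw [wordProd_concat, List.length_append, List.length_singleton] at hw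
    -- A descent here would make the word `w ++ [k]` too long to be reduced.
    have hasc : IsAsc (wordProd n w) k := by
      by_contra h
      have := invCount_of_not_isAsc h
      omega
    rw [invCount_mul_adjSwap hasc] at hw
    have hup : wordProd n (w ++ [k]) = BruhatInvol.upR k (wordProd n w) := by
      rw [BruhatInvol.upR, if_pos hasc, wordProd_concat]
    rw [hup]
    obtain ⟨u₁, u₂, rfl, hu₁, hu₂⟩ := List.sublist_append_iff.1 hu
    have h2 := ih hu₁ (by omega)
    rcases List.sublist_singleton.1 hu₂ with rfl | rfl
    · rw [List.append_nil]
      exact h2.trans (rankLE_upR k _)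
    · rw [wordProd_concat]
      by_cases h : IsAsc (wordProd n u₁) k
      · have := h2.upR k
        rwa [BruhatInvol.upR, if_pos h] at this
      · refine RankLE.trans ?_ (h2.trans (rankLE_upR k _))
        have := rankLE_downR k (wordProd n u₁)
        rwa [BruhatInvol.downR, if_neg h] at this

/-- Apply `downR` for the last letter to both sides: it deletes that letter from `w`, while on `π`
it either does nothing (skip the letter) or strips it (use the letter). -/
theorem RankLE.exists_sublist {π σ : Perm (Fin n)} (h : RankLE π σ) {w : List (Fin (n - 1))}
    (hw : wordProd n w = σ) (hl : w.length = invCount σ) :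
    ∃ u : List (Fin (n - 1)), u.Sublist w ∧ wordProd n u = π := by
  induction w using List.reverseRecOn generalizing π σ with
  | nil =>
    subst hw
    exact ⟨[], List.Sublist.refl _, (h.antisymm (one_rankLE π)).symm⟩
  | append_singleton w k ih =>
    subst hw
    have h1 := invCount_wordProd_le w
    rw [wordProd_concat, List.length_append, List.length_singleton] at hl
    have hasc : IsAsc (wordProd n w) k := by
      by_contra h
      have := invCount_of_not_isAsc h
      omega
    rw [invCount_mul_adjSwap hasc] at hl
    have hd : BruhatInvol.downR k (wordProd n (w ++ [k])) = wordProd n w := by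
      
      rw [wordProd_concat]
      have := downR_upR_of_isAsc hasc
      rwa [BruhatInvol.upR, if_pos hasc] at this
    have h2 := h.downR k
    rw [hd] at h2
    obtain ⟨u, hu, hπ⟩ := ih h2 rfl (by omega)
    rw [BruhatInvol.downR] at hπ
    split_ifs at hπ with ha
    · exact ⟨u, hu.trans (List.sublist_append_left _ _), hπ⟩
    · exact ⟨u ++ [k], hu.append (List.Sublist.refl _),
        by rw [wordProd_concat, hπ, mul_adjSwap_mul_self]⟩

theorem bruhatLE_iff_rankLE {π σ : Perm (Fin n)} : BruhatLE π σ ↔ RankLE π σ := by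
  constructor
  · rintro ⟨w, hw, u, hu, rfl⟩
    obtain ⟨rfl, hl⟩ := isReducedWord_iff.1 hw
    exact RankLE.of_sublist_reducedWord hu hl
  · intro h
    obtain ⟨w, hw, hl⟩ := exists_wordProd_eq σ
    exact ⟨w, isReducedWord_iff.2 ⟨hw, hl⟩, h.exists_sublist hw hl⟩

/-! ### The parameter as a count of cells, and its closed formula. -/

theorem rankControl_permMatrix (σ : Perm (Fin n)) (k l : ℕ) :
    rankControl (σ.permMatrix ℂ) k l = rk σ k l := by
  let S := {i : {i : Fin n // (i : ℕ) < k} // (σ i.1 : ℕ) < l}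
  -- The nonzero columns of the submatrix are distinct standard basis vectors, indexed by the rows
  -- whose one lies in the first `l` columns.
  let b : S → ({i : Fin n // (i : ℕ) < k} → ℂ) := fun i => Pi.single i.1 1
  have hb : LinearIndependent ℂ b := by
    have := (Pi.basisFun ℂ {i : Fin n // (i : ℕ) < k}).linearIndependent.comp
      (Subtype.val : S → _) Subtype.val_injective
    convert this using 1
    ext i j
    simp [b]
  have hcol : ∀ (j : {j : Fin n // (j : ℕ) < l}) (i : {i : Fin n // (i : ℕ) < k}),
      ((σ.permMatrix ℂ).submatrix (fun i : {i : Fin n // (i : ℕ) < k} => i.1)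
        (fun j : {j : Fin n // (j : ℕ) < l} => j.1)).col j i = if σ i.1 = j.1 then 1 else 0 := by
    intro j i
    simp [Matrix.col, PEquiv.toMatrix_apply, Perm.permMatrix, eq_comm]
  have hspan : Submodule.span ℂ (Set.range ((σ.permMatrix ℂ).submatrix
      (fun i : {i : Fin n // (i : ℕ) < k} => i.1)
      (fun j : {j : Fin n // (j : ℕ) < l} => j.1)).col) = Submodule.span ℂ (Set.range b) := by
    apply le_antisymm <;> rw [Submodule.span_le]
    · rintro _ ⟨j, rfl⟩
      by_cases h : ((σ⁻¹ j.1 : Fin n) : ℕ) < k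
      · refine Submodule.subset_span ⟨⟨⟨σ⁻¹ j.1, h⟩, by simpa using j.2⟩, ?_⟩
        ext i
        rw [hcol]
        simp only [b, Pi.single_apply, Subtype.ext_iff, Perm.eq_inv_iff_eq]
      · suffices e : ((σ.permMatrix ℂ).submatrix (fun i : {i : Fin n // (i : ℕ) < k} => i.1)
            (fun j : {j : Fin n // (j : ℕ) < l} => j.1)).col j = 0 by
          rw [e]; exact Submodule.zero_mem _
        ext i
        rw [hcol, if_neg, Pi.zero_apply]
        intro e
        apply h
        rw [← e, ← Perm.mul_apply, inv_mul_cancel]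
        exact i.2
    · rintro _ ⟨i, rfl⟩
      refine Submodule.subset_span ⟨⟨σ i.1.1, i.2⟩, ?_⟩
      ext a
      rw [hcol]
      simp only [b, Pi.single_apply, Subtype.ext_iff, σ.injective.eq_iff]
  rw [rankControl, Matrix.rank_eq_finrank_span_cols, hspan, finrank_span_eq_card hb, rk,
    Fintype.card_subtype, ← Finset.card_map (Function.Embedding.subtype _)]
  congr 1
  ext a
  simp [and_comm]

/-- The enlarged corner gains row `i` and column `j` up to their crossing; the rank is unchanged
exactly when this hook contains no one. -/
theorem rk_succ_succ_eq_iff (σ : Perm (Fin n)) (i j : Fin n) :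
    rk σ (i + 1) (j + 1) = rk σ i j ↔ j < σ i ∧ i < σ⁻¹ j := by
  have h1 := rk_succ σ i (j + 1)
  have h2 := rk_succ σ⁻¹ j i
  rw [rk_inv, rk_inv] at h2
  rw [h1, h2, Fin.lt_def, Fin.lt_def]
  have h3 : (σ⁻¹ j : ℕ) = i → (σ i : ℕ) = j := fun e => by
    have : σ⁻¹ j = i := Fin.ext e
    rw [← this, ← Perm.mul_apply, mul_inv_cancel]; rfl
  have h4 : (σ i : ℕ) = j → (σ⁻¹ j : ℕ) = i := fun e => by
    have : σ i = j := Fin.ext e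
    rw [← this, ← Perm.mul_apply, inv_mul_cancel]; rfl
  split_ifs <;> omega

theorem Invol.inv_eq (σ : Invol n) : σ.1⁻¹ = σ.1 := inv_eq_of_mul_eq_one_left σ.2

theorem Invol.apply_apply (σ : Invol n) (i : Fin n) : σ.1 (σ.1 i) = i :=
  DFunLike.congr_fun σ.2 i

theorem rankParam_eq_card (σ : Invol n) : rankParam σ = (Finset.univ.filter
    fun p : Fin n × Fin n => p.1 ≤ p.2 ∧ p.2 < σ.1 p.1 ∧ p.1 < σ.1 p.2).card := by
  rw [rankParam, diagEq]
  congr 1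
  ext p
  simp only [Finset.mem_filter, rankControl_permMatrix, rk_succ_succ_eq_iff, σ.inv_eq]

/-- The cells with `j < σ i` and `i < σ j` form a set symmetric about the diagonal. It has
`invCount` elements, `exc` of them diagonal, and its half including the diagonal has `rankParam`
elements. -/
theorem two_mul_rankParam (σ : Invol n) : 2 * rankParam σ = exc σ.1 + invCount σ.1 := by
  classical
  have hinv : invCount σ.1 = (Finset.univ.filter
      fun p : Fin n × Fin n => p.2 < σ.1 p.1 ∧ p.1 < σ.1 p.2).card := by
    rw [invCount]
    -- An inversion `(p, q)` corresponds to the cell `(p, σ q)`.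
    refine Finset.card_equiv ((Equiv.refl _).prodCongr σ.1) fun p => ?_
    simp [σ.apply_apply, and_comm]
  have hexc : exc σ.1 = (Finset.univ.filter fun p : Fin n × Fin n =>
      p.1 = p.2 ∧ p.2 < σ.1 p.1 ∧ p.1 < σ.1 p.2).card := by
    rw [exc]
    refine Finset.card_bij (fun i _ => (i, i)) ?_ ?_ ?_
    · simp
    · simp
    · rintro ⟨i, j⟩ h
      simp only [Finset.mem_filter, Finset.mem_univ, true_and] at h
      obtain ⟨rfl, h, -⟩ := h
      exact ⟨i, by simpa using h, rfl⟩
  have hsymm : rankParam σ = (Finset.univ.filter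
      fun p : Fin n × Fin n => p.2 ≤ p.1 ∧ p.2 < σ.1 p.1 ∧ p.1 < σ.1 p.2).card := by
    rw [rankParam_eq_card]
    refine Finset.card_equiv (Equiv.prodComm _ _) fun p => ?_
    simp [and_comm]
  rw [two_mul, hexc, hinv]
  nth_rewrite 1 [hsymm]
  rw [rankParam_eq_card, ← Finset.card_union_add_card_inter, add_comm]
  congr 2
  · ext p
    simp only [Finset.mem_inter, Finset.mem_filter, Finset.mem_univ, true_and]
    constructor
    · rintro ⟨⟨h1, h2⟩, h3, -⟩
      exact ⟨le_antisymm h3 h1, h2⟩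
    · rintro ⟨h1, h2⟩
      exact ⟨⟨h1.ge, h2⟩, h1.le, h2⟩
  · ext p
    simp only [Finset.mem_union, Finset.mem_filter, Finset.mem_univ, true_and]
    have := le_total p.1 p.2
    tauto

/-! ### The action of the generators on involutions -/

/-- `upR` on both sides. -/
noncomputable def up (k : Fin (n - 1)) (σ : Perm (Fin n)) : Perm (Fin n) :=
  (upR k (upR k σ)⁻¹)⁻¹

/-- `downR` on both sides. -/
noncomputable def down (k : Fin (n - 1)) (σ : Perm (Fin n)) : Perm (Fin n) :=
  (downR k (downR k σ)⁻¹)⁻¹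

theorem RankLE.up {π σ : Perm (Fin n)} (h : RankLE π σ) (k : Fin (n - 1)) :
    RankLE (up k π) (up k σ) :=
  ((h.upR k).inv.upR k).inv

theorem RankLE.down {π σ : Perm (Fin n)} (h : RankLE π σ) (k : Fin (n - 1)) :
    RankLE (down k π) (down k σ) :=
  ((h.downR k).inv.downR k).inv

theorem rankLE_down (k : Fin (n - 1)) (σ : Perm (Fin n)) : RankLE (down k σ) σ := by
  have h := (rankLE_downR k (downR k σ)⁻¹).inv
  rw [inv_inv] at h
  exact h.trans (rankLE_downR k σ)

theorem upR_of_isAsc {σ : Perm (Fin n)} {k : Fin (n - 1)} (h : IsAsc σ k) :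
    upR k σ = σ * adjSwap n k := if_pos h

theorem upR_of_not_isAsc {σ : Perm (Fin n)} {k : Fin (n - 1)} (h : ¬ IsAsc σ k) :
    upR k σ = σ := if_neg h

theorem downR_of_isAsc {σ : Perm (Fin n)} {k : Fin (n - 1)} (h : IsAsc σ k) :
    downR k σ = σ := if_pos h

theorem downR_of_not_isAsc {σ : Perm (Fin n)} {k : Fin (n - 1)} (h : ¬ IsAsc σ k) :
    downR k σ = σ * adjSwap n k := if_neg h

theorem Invol.up_of_not_isAsc (σ : Invol n) {k : Fin (n - 1)} (h : ¬ IsAsc σ.1 k) :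
    up k σ.1 = σ.1 := by
  rw [up, upR_of_not_isAsc h, σ.inv_eq, upR_of_not_isAsc h, σ.inv_eq]

theorem Invol.down_of_isAsc (σ : Invol n) {k : Fin (n - 1)} (h : IsAsc σ.1 k) :
    down k σ.1 = σ.1 := by
  rw [down, downR_of_isAsc h, σ.inv_eq, downR_of_isAsc h, σ.inv_eq]

theorem isAsc_adjSwap_mul {σ : Perm (Fin n)} {k : Fin (n - 1)}
    (h1 : ¬(σ (lo k) = lo k ∧ σ (hi k) = hi k)) (h2 : ¬(σ (lo k) = hi k ∧ σ (hi k) = lo k)) :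
    IsAsc (adjSwap n k * σ) k ↔ IsAsc σ k :=
  adjSwap_lt_iff k h1 h2

theorem mul_adjSwap_of_fixed {σ : Perm (Fin n)} {k : Fin (n - 1)}
    (h1 : σ (lo k) = lo k ∧ σ (hi k) = hi k) : σ * adjSwap n k = adjSwap n k * σ := by
  have := Equiv.mul_swap_eq_swap_mul σ (lo k) (hi k)
  rwa [h1.1, h1.2] at this

theorem mul_adjSwap_of_swapped {σ : Perm (Fin n)} {k : Fin (n - 1)}
    (h1 : σ (lo k) = hi k ∧ σ (hi k) = lo k) : σ * adjSwap n k = adjSwap n k * σ := by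
  have := Equiv.mul_swap_eq_swap_mul σ (lo k) (hi k)
  rwa [h1.1, h1.2, Equiv.swap_comm (hi k)] at this

/-- Here `σ` commutes with the transposition, so the right step has already created the left descent
and the left step is idle. -/
theorem Invol.up_of_fixed (σ : Invol n) {k : Fin (n - 1)}
    (h : σ.1 (lo k) = lo k ∧ σ.1 (hi k) = hi k) : up k σ.1 = σ.1 * adjSwap n k := by
  have ha : IsAsc σ.1 k := by rw [IsAsc, h.1, h.2]; exact lo_lt_hi k
  rw [up, upR_of_isAsc ha, mul_inv_rev, adjSwap_inv, σ.inv_eq, ← mul_adjSwap_of_fixed h,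
    upR_of_not_isAsc (by rw [isAsc_mul_adjSwap_iff]; exact not_not.2 ha), mul_inv_rev, adjSwap_inv,
    σ.inv_eq, mul_adjSwap_of_fixed h]

theorem Invol.up_of_isAsc (σ : Invol n) {k : Fin (n - 1)} (ha : IsAsc σ.1 k)
    (h : ¬(σ.1 (lo k) = lo k ∧ σ.1 (hi k) = hi k)) :
    up k σ.1 = adjSwap n k * σ.1 * adjSwap n k := by
  have h2 : ¬(σ.1 (lo k) = hi k ∧ σ.1 (hi k) = lo k) := by
    rintro ⟨h1, h2⟩
    rw [IsAsc, h1, h2] at ha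
    exact lt_asymm ha (lo_lt_hi k)
  rw [up, upR_of_isAsc ha, mul_inv_rev, adjSwap_inv, σ.inv_eq,
    upR_of_isAsc ((isAsc_adjSwap_mul h h2).2 ha), mul_inv_rev, mul_inv_rev, adjSwap_inv, σ.inv_eq,
    mul_assoc]

theorem Invol.down_of_swapped (σ : Invol n) {k : Fin (n - 1)}
    (h : σ.1 (lo k) = hi k ∧ σ.1 (hi k) = lo k) : down k σ.1 = σ.1 * adjSwap n k := by
  have ha : ¬ IsAsc σ.1 k := by rw [IsAsc, h.1, h.2]; exact (lo_lt_hi k).not_gt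
  rw [down, downR_of_not_isAsc ha, mul_inv_rev, adjSwap_inv, σ.inv_eq, ← mul_adjSwap_of_swapped h,
    downR_of_isAsc ((isAsc_mul_adjSwap_iff _ _).2 ha), mul_inv_rev, adjSwap_inv, σ.inv_eq,
    mul_adjSwap_of_swapped h]

theorem Invol.down_of_not_isAsc (σ : Invol n) {k : Fin (n - 1)} (ha : ¬ IsAsc σ.1 k)
    (h : ¬(σ.1 (lo k) = hi k ∧ σ.1 (hi k) = lo k)) :
    down k σ.1 = adjSwap n k * σ.1 * adjSwap n k := by
  have h2 : ¬(σ.1 (lo k) = lo k ∧ σ.1 (hi k) = hi k) := by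
    rintro ⟨h1, h2⟩
    rw [IsAsc, h1, h2] at ha
    exact ha (lo_lt_hi k)
  rw [down, downR_of_not_isAsc ha, mul_inv_rev, adjSwap_inv, σ.inv_eq,
    downR_of_not_isAsc fun h3 => ha ((isAsc_adjSwap_mul h2 h).1 h3), mul_inv_rev, mul_inv_rev,
    adjSwap_inv, σ.inv_eq, mul_assoc]

theorem conj_mul_self {G : Type*} [Group G] {s x : G} (hs : s * s = 1) (hx : x * x = 1) :
    s * x * s * (s * x * s) = 1 := by
  rw [show s * x * s * (s * x * s) = s * (x * (s * s) * x) * s by group, hs, mul_one, hx, mul_one,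
    hs]

theorem Invol.up_mul_self (σ : Invol n) (k : Fin (n - 1)) : up k σ.1 * up k σ.1 = 1 := by
  by_cases ha : IsAsc σ.1 k
  · by_cases h : σ.1 (lo k) = lo k ∧ σ.1 (hi k) = hi k
    · rw [σ.up_of_fixed h]
      nth_rewrite 1 [mul_adjSwap_of_fixed h]
      rw [mul_assoc, ← mul_assoc σ.1, σ.2, one_mul, adjSwap_mul_self]
    · rw [σ.up_of_isAsc ha h]
      exact conj_mul_self (adjSwap_mul_self k) σ.2
  · rw [σ.up_of_not_isAsc ha, σ.2]

theorem Invol.down_mul_self (σ : Invol n) (k : Fin (n - 1)) : down k σ.1 * down k σ.1 = 1 := by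
  by_cases ha : IsAsc σ.1 k
  · rw [σ.down_of_isAsc ha, σ.2]
  · by_cases h : σ.1 (lo k) = hi k ∧ σ.1 (hi k) = lo k
    · rw [σ.down_of_swapped h]
      nth_rewrite 1 [mul_adjSwap_of_swapped h]
      rw [mul_assoc, ← mul_assoc σ.1, σ.2, one_mul, adjSwap_mul_self]
    · rw [σ.down_of_not_isAsc ha h]
      exact conj_mul_self (adjSwap_mul_self k) σ.2

/-- The involution `up k σ`. -/
noncomputable def Invol.up (k : Fin (n - 1)) (σ : Invol n) : Invol n :=
  ⟨BruhatInvol.up k σ.1, σ.up_mul_self k⟩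

/-- The involution `down k σ`. -/
noncomputable def Invol.down (k : Fin (n - 1)) (σ : Invol n) : Invol n :=
  ⟨BruhatInvol.down k σ.1, σ.down_mul_self k⟩

theorem Invol.isAsc_down (σ : Invol n) (k : Fin (n - 1)) : IsAsc (σ.down k).1 k := by
  have h := isAsc_downR k (downR k σ.1)⁻¹
  -- The double inverse exhibits `down k σ`, which as an involution equals its inverse, so a left
  -- ascent is a right ascent.
  rw [← inv_inv (downR k (downR k σ.1)⁻¹)] at h
  change IsAsc (σ.down k).1⁻¹ k at h
  rwa [Invol.inv_eq] at h

theorem Invol.up_down (σ : Invol n) {k : Fin (n - 1)} (ha : ¬ IsAsc σ.1 k) :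
    (σ.down k).up k = σ := by
  have hd := σ.isAsc_down k
  refine Subtype.ext ?_
  by_cases h : σ.1 (lo k) = hi k ∧ σ.1 (hi k) = lo k
  · have e : (σ.down k).1 = σ.1 * adjSwap n k := σ.down_of_swapped h
    refine ((σ.down k).up_of_fixed ?_).trans (by rw [e, mul_adjSwap_mul_self])
    rw [e]
    simp [h]
  · have e : (σ.down k).1 = adjSwap n k * σ.1 * adjSwap n k := σ.down_of_not_isAsc ha h
    refine ((σ.down k).up_of_isAsc hd ?_).trans ?_
    · rw [e]
      simp only [Perm.mul_apply, adjSwap_lo, adjSwap_hi]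
      rintro ⟨h1, h2⟩
      apply ha
      have h1 := congrArg (adjSwap n k) h1
      have h2 := congrArg (adjSwap n k) h2
      simp only [adjSwap_apply_self, adjSwap_lo, adjSwap_hi] at h1 h2
      rw [IsAsc, h1, h2]
      exact lo_lt_hi k
    · rw [e, ← mul_assoc, ← mul_assoc, adjSwap_mul_self, one_mul, mul_adjSwap_mul_self]

/-! ### Effect of the action on the statistics. -/

theorem exc_mul_adjSwap_of_fixed {σ : Perm (Fin n)} {k : Fin (n - 1)}
    (h : σ (lo k) = lo k ∧ σ (hi k) = hi k) : exc (σ * adjSwap n k) = exc σ + 1 := by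
  have hmem : lo k ∉ Finset.univ.filter fun i : Fin n => i < σ i := by simp [h.1]
  rw [exc, exc, ← Finset.card_cons hmem]
  congr 1
  ext i
  rw [Finset.mem_cons, Finset.mem_filter, Finset.mem_filter]
  simp only [Finset.mem_univ, true_and, Perm.mul_apply]
  by_cases h1 : i = lo k
  · subst h1
    simp [h.2, lo_lt_hi]
  by_cases h2 : i = hi k
  · subst h2
    simp [h.1, h.2, (lo_lt_hi k).le, (lo_lt_hi k).ne']
  have : adjSwap n k i = i := swap_apply_of_ne_of_ne h1 h2
  simp [this, h1]

/-- The transposition preserves the order of `i` and `σ i` unless these are its own two points,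
which the hypotheses exclude. -/
theorem exc_conj_adjSwap {σ : Perm (Fin n)} {k : Fin (n - 1)} (h1 : σ (lo k) ≠ hi k)
    (h2 : σ (hi k) ≠ lo k) : exc (adjSwap n k * σ * adjSwap n k) = exc σ := by
  rw [exc, exc]
  refine Finset.card_equiv (adjSwap n k) fun i => ?_
  rw [Finset.mem_filter, Finset.mem_filter]
  simp only [Finset.mem_univ, true_and, Perm.mul_apply]
  rw [← adjSwap_lt_iff k (p := adjSwap n k i), adjSwap_apply_self]
  · rintro ⟨h3, h4⟩
    rw [h3] at h4
    exact h1 h4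
  · rintro ⟨h3, h4⟩
    rw [h3] at h4
    exact h2 h4

theorem invCount_inv (σ : Perm (Fin n)) : invCount σ⁻¹ = invCount σ := by
  rw [invCount, invCount]
  refine Finset.card_equiv ((σ⁻¹.prodCongr σ⁻¹).trans (Equiv.prodComm _ _)) fun p => ?_
  simp [and_comm]

theorem Invol.rankParam_up (σ : Invol n) {k : Fin (n - 1)} (ha : IsAsc σ.1 k) :
    rankParam (σ.up k) = rankParam σ + 1 := by
  have h1 := two_mul_rankParam σ
  have h2 := two_mul_rankParam (σ.up k)
  by_cases h : σ.1 (lo k) = lo k ∧ σ.1 (hi k) = hi k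
  · have e : (σ.up k).1 = σ.1 * adjSwap n k := σ.up_of_fixed h
    rw [e, exc_mul_adjSwap_of_fixed h, invCount_mul_adjSwap ha] at h2
    omega
  · have e : (σ.up k).1 = adjSwap n k * σ.1 * adjSwap n k := σ.up_of_isAsc ha h
    have h3 : σ.1 (lo k) ≠ hi k := fun h3 => by
      have h4 := σ.apply_apply (lo k)
      rw [h3] at h4
      rw [IsAsc, h3, h4] at ha
      exact lt_asymm ha (lo_lt_hi k)
    have h4 : σ.1 (hi k) ≠ lo k := fun h4 => h3 (by rw [← h4, σ.apply_apply])
    have h5 : invCount (adjSwap n k * σ.1) = invCount σ.1 + 1 := by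
      rw [← invCount_inv, mul_inv_rev, adjSwap_inv, σ.inv_eq, invCount_mul_adjSwap ha]
    rw [e, exc_conj_adjSwap h3 h4,
      invCount_mul_adjSwap ((isAsc_adjSwap_mul h fun h6 => h3 h6.1).2 ha), h5] at h2
    omega

theorem rankParam_one : rankParam (⟨1, one_mul 1⟩ : Invol n) = 0 := by
  have h := two_mul_rankParam (⟨1, one_mul 1⟩ : Invol n)
  have he : exc (1 : Perm (Fin n)) = 0 := by simp [exc]
  rw [he, invCount_one] at h
  omega

/-- A lifting property: `up` restores `x` from `x.down k` and leaves `z` alone. -/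
theorem Invol.rankLE_of_down (x z : Invol n) {k : Fin (n - 1)} (hx : ¬ IsAsc x.1 k)
    (hz : ¬ IsAsc z.1 k) (h : RankLE (x.down k).1 z.1) : RankLE x.1 z.1 := by
  have := RankLE.up h k
  rw [z.up_of_not_isAsc hz] at this
  rwa [← x.up_down hx]

theorem Invol.rankLE_up (x : Invol n) (k : Fin (n - 1)) : RankLE x.1 (x.up k).1 := by
  have h := (rankLE_upR k (upR k x.1)⁻¹).inv
  rw [inv_inv] at h
  exact (rankLE_upR k x.1).trans h

theorem Invol.not_isAsc_up (σ : Invol n) (k : Fin (n - 1)) : ¬ IsAsc (σ.up k).1 k := by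
  have h := not_isAsc_upR k (upR k σ.1)⁻¹
  rw [← inv_inv (upR k (upR k σ.1)⁻¹)] at h
  change ¬ IsAsc (σ.up k).1⁻¹ k at h
  rwa [Invol.inv_eq] at h

/-! ### Interpolation in the poset of involutions. -/

theorem hasCoatoms_invol : HasCoatoms (fun x y : Invol n => RankLE x.1 y.1) rankParam := by
  intro x y hxy hne
  induction hm : rankParam y using Nat.strong_induction_on generalizing x y with
  | _ m ih =>
    subst hm
    by_cases h : ∀ k, IsAsc y.1 k
    · refine absurd (Subtype.ext (hxy.antisymm ?_)) hne
      rw [eq_one_of_forall_isAsc _ h]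
      exact one_rankLE _
    push Not at h
    obtain ⟨k, hk⟩ := h
    have hy : rankParam y = rankParam (y.down k) + 1 := by
      rw [← (y.down k).rankParam_up (y.isAsc_down k), y.up_down hk]
    have hd := RankLE.down hxy k
    -- If `x` ascends at `k`, it already lies below `y.down k`, which serves as `z`.
    by_cases hx : IsAsc x.1 k
    · rw [x.down_of_isAsc hx] at hd
      exact ⟨y.down k, hd, rankLE_down k y.1, hy⟩
    have hne' : x.down k ≠ y.down k := fun e => hne (by rw [← x.up_down hx, e, y.up_down hk])
    obtain ⟨z, hxz, hzy, hz⟩ := ih _ (by omega) (x.down k) (y.down k) hd hne' rfl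
    -- If `z` ascends at `k`, lifting it restores the lost rank. If it descends, the lifting
    -- property puts `x` below `z`, hence below `y.down k`.
    by_cases hza : IsAsc z.1 k
    · refine ⟨z.up k, x.rankLE_of_down _ hx (z.not_isAsc_up k) (hxz.trans (z.rankLE_up k)), ?_, ?_⟩
      · have := RankLE.up hzy k
        change RankLE _ ((y.down k).up k).1 at this
        rwa [y.up_down hk] at this
      · rw [z.rankParam_up hza]; omega
    · exact ⟨y.down k, (x.rankLE_of_down z hx hza hxz).trans hzy, rankLE_down k y.1, hy⟩

theorem involLE_eq : involLE n = fun x y : Invol n => RankLE x.1 y.1 := by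
  ext x y
  exact bruhatLE_iff_rankLE

end Permutations

end BruhatInvol

theorem corollary8p3 (n : ℕ) :
    IsPartialOrder (BruhatInvol.Invol n) (BruhatInvol.involLE n) ∧
      BruhatInvol.IsGraded (BruhatInvol.involLE n) ∧
      BruhatInvol.IsRankFunction (BruhatInvol.involLE n)
        (fun σ : BruhatInvol.Invol n => BruhatInvol.rankParam σ) ∧
      ∀ σ : BruhatInvol.Invol n,
        (BruhatInvol.rankParam σ : ℚ) =
          ((BruhatInvol.exc σ.1 : ℚ) + (BruhatInvol.invCount σ.1 : ℚ)) / 2 := by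
  rw [BruhatInvol.involLE_eq]
  refine ⟨?_, ?_, ⟨?_, ?_⟩, ?_⟩
  · exact
      { refl := fun x => BruhatInvol.RankLE.refl x.1
        trans := fun _ _ _ h h' => BruhatInvol.RankLE.trans h h'
        antisymm := fun _ _ h h' => Subtype.ext (BruhatInvol.RankLE.antisymm h h') }
  · exact BruhatInvol.hasCoatoms_invol.isGraded (fun x => BruhatInvol.RankLE.refl x.1)
      fun _ _ _ h h' => BruhatInvol.RankLE.trans h h'
  · intro x hx
    -- The identity lies below every involution, so a minimal element must be the identity.
    rw [← hx ⟨1, one_mul 1⟩ (BruhatInvol.one_rankLE x.1)]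
    exact BruhatInvol.rankParam_one
  · exact fun x y h => BruhatInvol.hasCoatoms_invol.covers h
  · intro σ
    rw [eq_div_iff two_ne_zero, mul_comm]
    exact_mod_cast BruhatInvol.two_mul_rankParam σ
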